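/- **The graphs.** Let $G_0$ be the graph with two vertices joined by one edge, labelled $a$; both vertices are called boundary vertices. For $n\ge 0$ the graph $G_{n+1}$ is obtained from the labelled multigraph $G_n$ by the following replacement rules (those of the Schreier graphs of the Basilica group): every $b$-edge becomes an $a$-edge with the same ends; every $a$-edge that is not a loop, with ends $x,y$, is replaced by a new vertex carrying an $a$-loop together with one $b$-edge joining the new vertex to $x$ and one joining it to $y$; every $a$-loop at a vertex $x$ is replaced by a new vertex carrying an $a$-loop together with two $b$-edges joining the new vertex to $x$. The old vertices are kept, and $\partial G_n$ consists of the two vertices that come from $G_0$. **Dirichlet spectrum.** For vertices $x,y$ of $G_n$ let $c_{xy}$ be the number of edges joining $x$ and $y$. The Laplacian is $L_nf(x)=\sum_y c_{xy}(f(x)-f(y))$. The Dirichlet Laplacian on $G_n$ is its restriction to functions on $G_n\setminus\partial G_n$ (the rows and columns of the boundary vertices are deleted from the matrix of $L_n$). Let $c_n(\lambda)$ be the characteristic polynomial of the Dirichlet Laplacian; its roots are the Dirichlet eigenvalues of $G_n$, and they form the Dirichlet spectrum of $G_n$ (which is empty for $n=0$, where $c_0=1$). **The functions $\zeta_n$.**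 Let $\gamma_n$ be the monic polynomial whose roots are those roots of $c_n$ that are not roots of any $c_k$ with $k<n$, each with its multiplicity in $c_n$ (so $\gamma_0=1$, and $\gamma_n$ collects the eigenvalues first appearing at level $n$). For $n\ge1$ put $$\eta_n=\gamma_{n-1}\prod_{0\le 2j\le n-4}\gamma_{n-2j-3}^{2^j},\qquad \zeta_n=\frac{\gamma_n}{\eta_n},$$ where $\zeta_n$ is a rational function of $\lambda$. **Theorem.** Let $n\ge1$ and let $\tilde\lambda\in\mathbb{R}$ satisfy $\zeta_n(\tilde\lambda)=0$. Then there are $\delta>0$ and a labelling $\{I,I'\}=\{(\tilde\lambda-\delta,\tilde\lambda),(\tilde\lambda,\tilde\lambda+\delta)\}$ of the two one-sided intervals at $\tilde\lambda$ such that: 1. $I$ is a gap: for every $m\in\mathbb{N}$, $I$ contains no Dirichlet eigenvalue of $G_m$; 2. there are a sequence of natural numbers $k_j\to\infty$ and points $\mu_j\in I'$ such that $\mu_j$ is a Dirichlet eigenvalue of $G_{n+2k_j}$ for every $j$, and $\mu_j\to\tilde\lambda$ as $j\to\infty$. -/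

import Mathlib

open Polynomial Filter Topology

namespace Basilica

/-- A finite multigraph with two marked (boundary) vertices whose edges are labelled by the two
generators `a`, `b` of the Basilica group: edges labelled `a` joining two vertices, edges labelled
`b` joining two vertices, and loops labelled `a`.  (There are no loops labelled `b` in the graphs
below.)  The two ends of an edge are listed in an arbitrary order; the graph is not oriented. -/
structure LabelledGraph where
  Vertex : Type
  AEdge : Type
  BEdge : Type
  ALoop : Type
  aEnds : AEdge → Vertex × Vertex
  bEnds : BEdge → Vertex × Vertex
  loopAt : ALoop → Vertex
  bdry : Bool → Vertex
  [fintypeVertex : Fintype Vertex]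
  [fintypeAEdge : Fintype AEdge]
  [fintypeBEdge : Fintype BEdge]
  [fintypeALoop : Fintype ALoop]
  [decEqVertex : DecidableEq Vertex]
  [decEqAEdge : DecidableEq AEdge]
  [decEqBEdge : DecidableEq BEdge]
  [decEqALoop : DecidableEq ALoop]

attribute [instance] LabelledGraph.fintypeVertex LabelledGraph.fintypeAEdge
  LabelledGraph.fintypeBEdge LabelledGraph.fintypeALoop LabelledGraph.decEqVertex
  LabelledGraph.decEqAEdge LabelledGraph.decEqBEdge LabelledGraph.decEqALoop

/-- One application of the replacement rules of the Basilica Schreier graphs: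
* a `b`-edge becomes an `a`-edge with the same ends;
* an `a`-edge with ends `x`, `y` is replaced by a new vertex carrying an `a`-loop, and two
  `b`-edges, which join the new vertex to `x` and to `y`;
* an `a`-loop at `x` is replaced by a new vertex carrying an `a`-loop, and two `b`-edges, both
  joining the new vertex to `x`.

The old vertices are kept, and so are the two boundary vertices. -/
def LabelledGraph.replace (G : LabelledGraph) : LabelledGraph where
  Vertex := G.Vertex ⊕ (G.AEdge ⊕ G.ALoop)
  AEdge := G.BEdge
  BEdge := (G.AEdge ⊕ G.ALoop) × Bool
  ALoop := G.AEdge ⊕ G.ALoop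
  aEnds := fun e => (Sum.inl (G.bEnds e).1, Sum.inl (G.bEnds e).2)
  bEnds := fun p =>
    match p with
    | (Sum.inl e, false) => (Sum.inl (G.aEnds e).1, Sum.inr (Sum.inl e))
    | (Sum.inl e, true) => (Sum.inl (G.aEnds e).2, Sum.inr (Sum.inl e))
    | (Sum.inr l, _) => (Sum.inl (G.loopAt l), Sum.inr (Sum.inr l))
  loopAt := fun v => Sum.inr v
  bdry := fun i => Sum.inl (G.bdry i)

/-- The graph with two vertices, both of them boundary vertices, and one edge, labelled `a`,
joining them. -/
def initialGraph : LabelledGraph where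
  Vertex := Bool
  AEdge := Unit
  BEdge := Empty
  ALoop := Empty
  aEnds := fun _ => (false, true)
  bEnds := fun e => e.elim
  loopAt := fun e => e.elim
  bdry := id

/-- The graph `G_n`, obtained from `G_0` by applying the replacement rules `n` times. -/
def graph : ℕ → LabelledGraph
  | 0 => initialGraph
  | n + 1 => (graph n).replace

/-- The edges of the multigraph, with the labels forgotten. -/
abbrev LabelledGraph.Edge (G : LabelledGraph) : Type :=
  G.AEdge ⊕ (G.BEdge ⊕ G.ALoop)

/-- The unordered pair of ends of an edge. -/
def LabelledGraph.ends (G : LabelledGraph) : G.Edge → Sym2 G.Vertex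
  | Sum.inl e => s((G.aEnds e).1, (G.aEnds e).2)
  | Sum.inr (Sum.inl e) => s((G.bEnds e).1, (G.bEnds e).2)
  | Sum.inr (Sum.inr l) => s(G.loopAt l, G.loopAt l)

/-- `c_{xy}`, the number of edges joining `x` and `y`. -/
def LabelledGraph.edgeCount (G : LabelledGraph) (x y : G.Vertex) : ℕ :=
  Fintype.card {e : G.Edge // G.ends e = s(x, y)}

theorem LabelledGraph.edgeCount_comm (G : LabelledGraph) (x y : G.Vertex) :
    G.edgeCount x y = G.edgeCount y x := by
  unfold LabelledGraph.edgeCount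
  rw [Sym2.eq_swap]

/-- The matrix of the graph Laplacian `(L f)(x) = ∑_y c_{xy} (f x - f y)`,
see `laplacian_mulVec`. -/
def LabelledGraph.laplacian (G : LabelledGraph) : Matrix G.Vertex G.Vertex ℝ :=
  Matrix.of fun x y => (if x = y then ∑ z, (G.edgeCount x z : ℝ) else 0) - (G.edgeCount x y : ℝ)

theorem LabelledGraph.laplacian_mulVec (G : LabelledGraph) (f : G.Vertex → ℝ) (x : G.Vertex) :
    (G.laplacian.mulVec f) x = ∑ y, (G.edgeCount x y : ℝ) * (f x - f y) := by
  simp [LabelledGraph.laplacian, Matrix.mulVec, dotProduct, sub_mul, mul_sub,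
    Finset.sum_sub_distrib, Finset.sum_mul]

/-- The vertices that are not boundary vertices. -/
abbrev LabelledGraph.Interior (G : LabelledGraph) : Type :=
  {x : G.Vertex // ∀ i, x ≠ G.bdry i}

/-- The matrix of the Dirichlet Laplacian on functions on the interior vertices: the rows and
columns of the boundary vertices are deleted from the matrix of the Laplacian. -/
def LabelledGraph.dirichletLaplacian (G : LabelledGraph) : Matrix G.Interior G.Interior ℝ :=
  G.laplacian.submatrix Subtype.val Subtype.val

/-- The set of eigenvalues of the Dirichlet Laplacian on `G_n`. -/
def dirichletSpectrum (n : ℕ) : Set ℝ :=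
  spectrum ℝ (graph n).dirichletLaplacian

/-- `c_n`, the characteristic polynomial of the Dirichlet Laplacian on `G_n`. -/
noncomputable def dirichletCharpoly (n : ℕ) : ℝ[X] :=
  (graph n).dirichletLaplacian.charpoly

open Classical in
/-- `γ_n`, the factor of `c_n` belonging to the eigenvalues that are first seen at level `n`:
the monic polynomial whose roots are, with the multiplicity that they have in `c_n`, the roots
of `c_n` that are not roots of any `c_k` with `k < n`.  Since all `c_n` split over `ℝ`, this is the
only possible choice of monic polynomials with `γ_0 = 1`, `γ_n` coprime to `γ_k` for `k < n`, and
`c_n` the product of `γ_n` and of powers of the `γ_k` with `1 ≤ k < n`, see `gamma_unique`. -/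
noncomputable def gamma (n : ℕ) : ℝ[X] :=
  (((dirichletCharpoly n).roots.filter
    (fun t => ∀ k < n, ¬ (dirichletCharpoly k).IsRoot t)).map (fun t => X - C t)).prod

theorem dirichletCharpoly_splits (n : ℕ) : (dirichletCharpoly n).Splits := by
  have h : (graph n).dirichletLaplacian.IsHermitian := by
    ext x y
    simp only [LabelledGraph.dirichletLaplacian, LabelledGraph.laplacian, Matrix.conjTranspose_apply,
      Matrix.submatrix_apply, Matrix.of_apply, star_trivial, (graph n).edgeCount_comm y.1 x.1]
    by_cases hxy : x = y
    · subst hxy; rfl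
    · have h1 : x.1 ≠ y.1 := fun h => hxy (Subtype.ext h)
      simp [h1, h1.symm]
  exact h.splits_charpoly

theorem gamma_unique (g : ℕ → ℝ[X]) (s : ℕ → ℕ → ℕ) (hmonic : ∀ n, (g n).Monic)
    (h0 : g 0 = 1) (hcop : ∀ n, ∀ k < n, IsCoprime (g n) (g k))
    (hfac : ∀ n, 1 ≤ n → dirichletCharpoly n = g n * ∏ k ∈ Finset.Ico 1 n, g k ^ s n k) :
    g = gamma := by
  classical
  have hc0 : dirichletCharpoly 0 = 1 := by
    have : IsEmpty (graph 0).Interior := ⟨fun x => x.2 x.1 rfl⟩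
    simp [dirichletCharpoly, Matrix.charpoly]
  have hgc : ∀ k t, (g k).IsRoot t → (dirichletCharpoly k).IsRoot t := by
    intro k t ht
    rcases Nat.eq_zero_or_pos k with rfl | hk
    · simp [h0] at ht
    · rw [hfac k hk]
      exact root_mul_right_of_isRoot _ ht
  have hcg : ∀ k t, (dirichletCharpoly k).IsRoot t → ∃ j ≤ k, (g j).IsRoot t := by
    intro k t ht
    rcases Nat.eq_zero_or_pos k with rfl | hk
    · simp [hc0] at ht
    · rw [hfac k hk, root_mul] at ht
      rcases ht with ht | ht
      · exact ⟨k, le_rfl, ht⟩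
      · rw [IsRoot.def, eval_prod, Finset.prod_eq_zero_iff] at ht
        obtain ⟨j, hj, hj0⟩ := ht
        rw [eval_pow] at hj0
        exact ⟨j, (Finset.mem_Ico.1 hj).2.le, eq_zero_of_pow_eq_zero hj0⟩
  funext n
  rcases Nat.eq_zero_or_pos n with rfl | hn
  · simp [gamma, hc0, h0]
  have hP : (∏ k ∈ Finset.Ico 1 n, g k ^ s n k).Monic :=
    monic_prod_of_monic _ _ fun k _ => (hmonic k).pow _
  have hne : g n * ∏ k ∈ Finset.Ico 1 n, g k ^ s n k ≠ 0 := ((hmonic n).mul hP).ne_zero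
  have hsplit : (g n).Splits :=
    (dirichletCharpoly_splits n).of_dvd (hfac n hn ▸ hne) (hfac n hn ▸ Dvd.intro _ rfl)
  have hfilter : (dirichletCharpoly n).roots.filter
      (fun t => ∀ k < n, ¬ (dirichletCharpoly k).IsRoot t) = (g n).roots := by
    rw [hfac n hn, roots_mul hne, Multiset.filter_add, Multiset.filter_eq_self.2,
      Multiset.filter_eq_nil.2, add_zero]
    · intro t ht hall
      have ht' := (mem_roots'.1 ht).2
      rw [IsRoot.def, eval_prod, Finset.prod_eq_zero_iff] at ht'
      obtain ⟨j, hj, hj0⟩ := ht'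
      rw [eval_pow] at hj0
      exact hall j (Finset.mem_Ico.1 hj).2 (hgc j t (eq_zero_of_pow_eq_zero hj0))
    · intro t ht k hk hroot
      obtain ⟨j, hj, hjt⟩ := hcg k t hroot
      obtain ⟨u, v, huv⟩ := hcop n j (hj.trans_lt hk)
      have h1 := congrArg (eval t) huv
      have ht' := (mem_roots'.1 ht).2
      simp [IsRoot.def.1 ht', IsRoot.def.1 hjt] at h1
  rw [gamma, hfilter]
  exact hsplit.eq_prod_roots_of_monic (hmonic n)

/-- `η_n = γ_{n-1} ∏_{0 ≤ 2j ≤ n-4} γ_{n-2j-3}^{2^j}`, for `n ≥ 1`. -/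
noncomputable def eta (n : ℕ) : ℝ[X] :=
  gamma (n - 1) * ∏ j ∈ (Finset.range n).filter (fun j => 2 * j + 4 ≤ n),
    gamma (n - 2 * j - 3) ^ (2 ^ j)

/-- The rational function `ζ_n = γ_n / η_n`, for `n ≥ 1`. -/
noncomputable def zeta (n : ℕ) : RatFunc ℝ :=
  algebraMap ℝ[X] (RatFunc ℝ) (gamma n) / algebraMap ℝ[X] (RatFunc ℝ) (eta n)

/-- The interval `I` contains a sequence `μ_j` of Dirichlet eigenvalues of `G_{n+2k_j}`, where
`k_j → ∞`, that accumulates at `t`. -/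
def EigenvaluesAccumulate (n : ℕ) (t : ℝ) (I : Set ℝ) : Prop :=
  ∃ (k : ℕ → ℕ) (μ : ℕ → ℝ), Tendsto k atTop atTop ∧
    (∀ j, μ j ∈ I ∧ μ j ∈ dirichletSpectrum (n + 2 * k j)) ∧
    Tendsto μ atTop (𝓝 t)

/-- `I` is a gap: it contains no Dirichlet eigenvalue of any `G_m`. -/
def IsGap (I : Set ℝ) : Prop :=
  ∀ m : ℕ, Disjoint I (dirichletSpectrum m)

end Basilica

namespace Basilica

/-! Collapsing the newest vertices of a network on `G_(n+1)` by a Schur complement gives a network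
of the same kind on `G_n`. Each new vertex has the same diagonal entry, up to sign the pivot `z_k`,
and with `b_k` the off-diagonal responses one gets `b_(k+2) = b_k² / z_k` and `z_(k+1) = z_k + 2
b_(k+1) - 4 b_(k+2)`. Nonzero pivots `z_0, ..., z_(n-1)` exclude an eigenvalue of `G_n`; an
eigenvalue first seen at level `n + 1` is a point where `z_n` is the first pivot to vanish. A zero
of `ζ` is such a point `t`.

Responses are monotone in the spectral parameter, so `z_n` has derivative at least 1 and changes
sign at `t`. On either side, a common change of sign of all `z_k` and `b_k` makes `z_n` tend to 0
from below. Then `b_(n+4)` tends to `+∞`, `b_(n+3)` to 0 and `z_(n+3)` to `4d`, where `d` is the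
normalized value of `b_(n+1)` at `t`. This value is nonzero and has opposite signs on the two sides.

If `d > 0`, the later pivots stay positive (`IsPivotSeq.escape`), which gives the gap. If `d < 0`,
the pivots alternate in sign, but at a fixed point this must end (`IsPivotSeq.exists_nonpos`),
although it lasts longer and longer as `t` is approached. The intermediate value theorem then yields
zeros of later and later pivots, hence eigenvalues tending to `t` (`exists_pivot_eq_zero`). -/

/-! ### Networks and the elimination of one generation of vertices -/

/-- The contribution at `x` of an edge with ends `p`, `q` and response matrix `(a, b; b, a)`. -/
def edgeOp {V : Type} [DecidableEq V] (a b : ℝ) (p q : V) (f : V → ℝ) (x : V) : ℝ :=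
  (if p = x then a * f p + b * f q else 0) + (if q = x then a * f q + b * f p else 0)

/-- The operator of the network on `G` whose `a`-edges and `a`-loops have the response matrix
`(a₁, b₁; b₁, a₁)` and whose `b`-edges have the response matrix `(a₀, b₀; b₀, a₀)`, minus `l`. -/
def LabelledGraph.op (G : LabelledGraph) (a₀ b₀ a₁ b₁ l : ℝ) (f : G.Vertex → ℝ)
    (x : G.Vertex) : ℝ :=
  ∑ e, edgeOp a₁ b₁ (G.aEnds e).1 (G.aEnds e).2 f x +
    ∑ e, edgeOp a₀ b₀ (G.bEnds e).1 (G.bEnds e).2 f x +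
    ∑ e, edgeOp a₁ b₁ (G.loopAt e) (G.loopAt e) f x - l * f x

/-- The network operator has a nonzero Dirichlet null function. -/
def LabelledGraph.HasKernel (G : LabelledGraph) (a₀ b₀ a₁ b₁ l : ℝ) : Prop :=
  ∃ f : G.Vertex → ℝ, f ≠ 0 ∧ (∀ i, f (G.bdry i) = 0) ∧
    ∀ x, (∀ i, x ≠ G.bdry i) → G.op a₀ b₀ a₁ b₁ l f x = 0

/-- The two ends in `G` of the path replacing an `a`-edge or an `a`-loop. -/
def LabelledGraph.oldEnds (G : LabelledGraph) : G.AEdge ⊕ G.ALoop → G.Vertex × G.Vertex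
  | Sum.inl e => G.aEnds e
  | Sum.inr e => (G.loopAt e, G.loopAt e)

theorem LabelledGraph.op_replace (G : LabelledGraph) (a₀ b₀ a₁ b₁ l : ℝ)
    (f : G.Vertex ⊕ (G.AEdge ⊕ G.ALoop) → ℝ) (x : G.Vertex ⊕ (G.AEdge ⊕ G.ALoop)) :
    G.replace.op a₀ b₀ a₁ b₁ l f x =
      ∑ e, edgeOp a₁ b₁ (Sum.inl (G.bEnds e).1) (Sum.inl (G.bEnds e).2) f x +
        ∑ v, (edgeOp a₀ b₀ (Sum.inl (G.oldEnds v).1) (Sum.inr v) f x +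
          edgeOp a₀ b₀ (Sum.inl (G.oldEnds v).2) (Sum.inr v) f x) +
        ∑ v, edgeOp a₁ b₁ (Sum.inr v) (Sum.inr v) f x - l * f x := by
  have h : ∑ e : (G.AEdge ⊕ G.ALoop) × Bool,
      edgeOp a₀ b₀ (G.replace.bEnds e).1 (G.replace.bEnds e).2 f x =
      ∑ v, (edgeOp a₀ b₀ (Sum.inl (G.oldEnds v).1) (Sum.inr v) f x +
          edgeOp a₀ b₀ (Sum.inl (G.oldEnds v).2) (Sum.inr v) f x) := by
    -- The sum over `Bool` lists `true` first, hence the commutation for `a`-edges; at a loop the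
    -- two `b`-edges coincide.
    rw [Fintype.sum_prod_type]
    refine Finset.sum_congr rfl fun v _ => ?_
    rw [Fintype.sum_bool]
    rcases v with e | e
    · exact add_comm _ _
    · rfl
  rw [← h]
  rfl

/-- A new vertex meets only its two `b`-edges and its own loop. They contribute `2 * a₀` and `2 *
(a₁ + b₁)` to the diagonal, so new vertices are not coupled to each other. -/
theorem LabelledGraph.op_replace_inr (G : LabelledGraph) (a₀ b₀ a₁ b₁ l : ℝ)
    (f : G.Vertex ⊕ (G.AEdge ⊕ G.ALoop) → ℝ) (v : G.AEdge ⊕ G.ALoop) :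
    G.replace.op a₀ b₀ a₁ b₁ l f (Sum.inr v) =
      b₀ * (f (Sum.inl (G.oldEnds v).1) + f (Sum.inl (G.oldEnds v).2)) -
        (l - 2 * a₀ - 2 * (a₁ + b₁)) * f (Sum.inr v) := by
  rw [G.op_replace]
  simp only [edgeOp, reduceCtorEq, if_false, Sum.inr.injEq, zero_add, add_zero,
    Finset.sum_const_zero, Finset.sum_add_distrib, Finset.sum_ite_eq', Finset.mem_univ, if_true]
  ring

theorem LabelledGraph.op_replace_inl (G : LabelledGraph) (a₀ b₀ a₁ b₁ l : ℝ)
    (f : G.Vertex ⊕ (G.AEdge ⊕ G.ALoop) → ℝ)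
    (hf : ∀ v, f (Sum.inr v) = b₀ * (f (Sum.inl (G.oldEnds v).1) + f (Sum.inl (G.oldEnds v).2)) /
      (l - 2 * a₀ - 2 * (a₁ + b₁))) (x : G.Vertex) :
    G.replace.op a₀ b₀ a₁ b₁ l f (Sum.inl x) =
      G.op a₁ b₁ (a₀ + b₀ ^ 2 / (l - 2 * a₀ - 2 * (a₁ + b₁)))
        (b₀ ^ 2 / (l - 2 * a₀ - 2 * (a₁ + b₁))) l (fun y => f (Sum.inl y)) x := by
  have hL : ∀ v, edgeOp a₁ b₁ (Sum.inr v) (Sum.inr v) f (Sum.inl x) = 0 := by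
    intro v
    simp [edgeOp]
  have hA : ∀ p q : G.Vertex, edgeOp a₁ b₁ (Sum.inl p) (Sum.inl q) f (Sum.inl x) =
      edgeOp a₁ b₁ p q (fun y => f (Sum.inl y)) x := by
    intro p q
    simp [edgeOp]
  have hB : ∀ v, edgeOp a₀ b₀ (Sum.inl (G.oldEnds v).1) (Sum.inr v) f (Sum.inl x) +
      edgeOp a₀ b₀ (Sum.inl (G.oldEnds v).2) (Sum.inr v) f (Sum.inl x) =
      edgeOp (a₀ + b₀ ^ 2 / (l - 2 * a₀ - 2 * (a₁ + b₁)))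
        (b₀ ^ 2 / (l - 2 * a₀ - 2 * (a₁ + b₁))) (G.oldEnds v).1 (G.oldEnds v).2
        (fun y => f (Sum.inl y)) x := by
    intro v
    simp only [edgeOp, hf v, Sum.inl.injEq, reduceCtorEq, if_false, add_zero]
    congr 1 <;> refine if_congr Iff.rfl ?_ rfl <;> ring
  rw [G.op_replace, LabelledGraph.op]
  simp only [hA, hB, hL, Finset.sum_const_zero]
  simp only [Fintype.sum_sum_type, LabelledGraph.oldEnds]
  ring

/-- Schur complement: with a nonzero pivot, the equation at a new vertex determines the value there
from the old values, so restriction and this extension match the null functions. -/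
theorem LabelledGraph.hasKernel_replace_iff (G : LabelledGraph) (a₀ b₀ a₁ b₁ l : ℝ)
    (hz : l - 2 * a₀ - 2 * (a₁ + b₁) ≠ 0) :
    G.replace.HasKernel a₀ b₀ a₁ b₁ l ↔
      G.HasKernel a₁ b₁ (a₀ + b₀ ^ 2 / (l - 2 * a₀ - 2 * (a₁ + b₁)))
        (b₀ ^ 2 / (l - 2 * a₀ - 2 * (a₁ + b₁))) l := by
  constructor
  · rintro ⟨f, hf0, hfb, hf⟩
    have hv : ∀ v, f (Sum.inr v) =
        b₀ * (f (Sum.inl (G.oldEnds v).1) + f (Sum.inl (G.oldEnds v).2)) /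
          (l - 2 * a₀ - 2 * (a₁ + b₁)) := by
      intro v
      have h := hf (Sum.inr v) fun i h => Sum.inr_ne_inl h
      have h := (G.op_replace_inr _ _ _ _ _ f v).symm.trans h
      rw [eq_div_iff hz]
      linarith
    refine ⟨fun y => f (Sum.inl y), fun h0 => hf0 ?_, hfb, fun x hx => ?_⟩
    · have h0' : ∀ y, f (Sum.inl y) = 0 := fun y => congrFun h0 y
      funext y
      rcases y with y | v
      · exact h0' y
      · rw [hv v, h0', h0', add_zero, mul_zero, zero_div]; rfl
    · rw [← G.op_replace_inl _ _ _ _ _ f hv]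
      exact hf _ fun i h => hx i (Sum.inl_injective h)
  · rintro ⟨g, hg0, hgb, hg⟩
    let f : G.replace.Vertex → ℝ := Sum.elim g fun v =>
      b₀ * (g (G.oldEnds v).1 + g (G.oldEnds v).2) / (l - 2 * a₀ - 2 * (a₁ + b₁))
    have hv : ∀ v, f (Sum.inr v) =
        b₀ * (f (Sum.inl (G.oldEnds v).1) + f (Sum.inl (G.oldEnds v).2)) /
          (l - 2 * a₀ - 2 * (a₁ + b₁)) := fun v => rfl
    refine ⟨f, fun h0 => hg0 ?_, hgb, fun x hx => ?_⟩
    · funext y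
      exact congrFun h0 (Sum.inl y)
    · rcases x with x | v
      · exact (G.op_replace_inl _ _ _ _ _ f hv x).trans
          (hg x fun i h => hx i (congrArg Sum.inl h))
      · refine (G.op_replace_inr _ _ _ _ _ f v).trans ?_
        rw [hv v]
        field_simp
        simp

theorem not_hasKernel_initialGraph (a₀ b₀ a₁ b₁ l : ℝ) :
    ¬ initialGraph.HasKernel a₀ b₀ a₁ b₁ l := by
  rintro ⟨f, hf0, hfb, -⟩
  exact hf0 (funext fun x => hfb x)

/-- The single interior vertex has the pivot as its whole diagonal entry, so its indicator is a null
function. -/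
theorem hasKernel_replace_initialGraph (a₀ b₀ a₁ b₁ l : ℝ)
    (hz : l - 2 * a₀ - 2 * (a₁ + b₁) = 0) :
    initialGraph.replace.HasKernel a₀ b₀ a₁ b₁ l := by
  let f : initialGraph.replace.Vertex → ℝ := Sum.elim (fun _ => 0) (fun _ => 1)
  refine ⟨f, fun h0 => one_ne_zero (α := ℝ) ?_, fun i => rfl, fun x hx => ?_⟩
  · exact congrFun h0 (Sum.inr (Sum.inl ()))
  · rcases x with x | v
    · exact absurd rfl (hx x)
    · refine (initialGraph.op_replace_inr _ _ _ _ _ f v).trans ?_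
      change b₀ * ((0 : ℝ) + 0) - _ * 1 = 0
      rw [hz]
      ring

/-! ### The Dirichlet Laplacian as a network operator -/

theorem LabelledGraph.laplacian_mulVec_eq_op (G : LabelledGraph) (l : ℝ) (f : G.Vertex → ℝ)
    (x : G.Vertex) :
    (G.laplacian.mulVec f) x - l * f x = G.op 1 (-1) 1 (-1) l f x := by
  have key : ∀ p q : G.Vertex,
      ∑ y, (if s(p, q) = s(x, y) then f x - f y else 0) = edgeOp 1 (-1) p q f x := by
    intro p q
    by_cases hp : p = x
    · subst hp
      by_cases hq : q = p
      · subst hq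
        have : ∀ y, (s(q, q) = s(q, y)) = (y = q) := fun y => by
          simp [eq_comm]
        simp [edgeOp, this]
      · have : ∀ y, (s(p, q) = s(p, y)) = (y = q) := fun y => by
          simp [hq, eq_comm]
        simp [edgeOp, this, hq, sub_eq_add_neg]
    · by_cases hq : q = x
      · subst hq
        have : ∀ y, (s(p, q) = s(q, y)) = (y = p) := fun y => by
          simp [hp, eq_comm]
        simp [edgeOp, this, hp, sub_eq_add_neg]
      · have : ∀ y, (s(p, q) = s(x, y)) = False := fun y => by
          simp [hp, hq]
        simp [edgeOp, this, hp, hq]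
  have h1 : ∀ y, (G.edgeCount x y : ℝ) * (f x - f y) =
      ∑ e, if G.ends e = s(x, y) then f x - f y else 0 := by
    intro y
    rw [← Finset.sum_filter, Finset.sum_const, nsmul_eq_mul, LabelledGraph.edgeCount,
      Fintype.card_subtype]
  rw [G.laplacian_mulVec, Finset.sum_congr rfl fun y _ => h1 y, Finset.sum_comm,
    Fintype.sum_sum_type, Fintype.sum_sum_type, LabelledGraph.op]
  have hA : ∀ e : G.AEdge, ∑ y, (if G.ends (Sum.inl e) = s(x, y) then f x - f y else 0) =
      edgeOp 1 (-1) (G.aEnds e).1 (G.aEnds e).2 f x := fun e => key _ _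
  have hB : ∀ e : G.BEdge, ∑ y, (if G.ends (Sum.inr (Sum.inl e)) = s(x, y) then f x - f y else 0) =
      edgeOp 1 (-1) (G.bEnds e).1 (G.bEnds e).2 f x := fun e => key _ _
  have hL : ∀ e : G.ALoop, ∑ y, (if G.ends (Sum.inr (Sum.inr e)) = s(x, y) then f x - f y else 0) =
      edgeOp 1 (-1) (G.loopAt e) (G.loopAt e) f x := fun e => key _ _
  rw [Finset.sum_congr rfl fun e _ => hA e, Finset.sum_congr rfl fun e _ => hB e,
    Finset.sum_congr rfl fun e _ => hL e]
  ring

theorem LabelledGraph.mem_spectrum_iff (G : LabelledGraph) (l : ℝ) :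
    l ∈ spectrum ℝ G.dirichletLaplacian ↔ G.HasKernel 1 (-1) 1 (-1) l := by
  classical
  have hsub : ∀ (f : G.Vertex → ℝ), (∀ i, f (G.bdry i) = 0) → ∀ x : G.Interior,
      (G.dirichletLaplacian.mulVec fun y => f y.1) x = (G.laplacian.mulVec f) x.1 := by
    intro f hf x
    have h1 : (G.laplacian.mulVec f) x.1 =
        ∑ y ∈ Finset.univ.filter (fun y => ∀ i, y ≠ G.bdry i), G.laplacian x.1 y * f y := by
      refine (Finset.sum_subset (Finset.subset_univ _) fun y _ hy => ?_).symm
      simp only [Finset.mem_filter, Finset.mem_univ, true_and, not_forall, not_not] at hy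
      obtain ⟨i, rfl⟩ := hy
      rw [hf i, mul_zero]
    rw [h1]
    exact (Finset.sum_subtype _ (by simp) fun y => G.laplacian x.1 y * f y).symm
  rw [← Matrix.spectrum_toLin', ← Module.End.hasEigenvalue_iff_mem_spectrum]
  constructor
  · intro h
    obtain ⟨g, hg⟩ := h.exists_hasEigenvector
    have hg1 := hg.apply_eq_smul
    rw [Matrix.toLin'_apply] at hg1
    let f : G.Vertex → ℝ := fun y => if h : ∀ i, y ≠ G.bdry i then g ⟨y, h⟩ else 0
    have hfg : (fun y : G.Interior => f y.1) = g := by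
      funext y
      exact dif_pos y.2
    have hfb : ∀ i, f (G.bdry i) = 0 := fun i => dif_neg fun h => h i rfl
    refine ⟨f, fun h0 => hg.2 ?_, hfb, fun x hx => ?_⟩
    · rw [← hfg, h0]; rfl
    · rw [← G.laplacian_mulVec_eq_op, ← hsub f hfb ⟨x, hx⟩, hfg, hg1, ← hfg]
      exact sub_self _
  · rintro ⟨f, hf0, hfb, hf⟩
    refine Module.End.hasEigenvalue_of_hasEigenvector (x := fun y : G.Interior => f y.1)
      ⟨Module.End.mem_eigenspace_iff.2 ?_, fun h0 => hf0 ?_⟩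
    · rw [Matrix.toLin'_apply]
      funext x
      have := hf x.1 x.2
      rw [← G.laplacian_mulVec_eq_op, ← hsub f hfb x, sub_eq_zero] at this
      exact this
    · funext y
      by_cases hy : ∀ i, y ≠ G.bdry i
      · exact congrFun h0 ⟨y, hy⟩
      · push Not at hy
        obtain ⟨i, rfl⟩ := hy
        exact hfb i

/-! ### Responses, pivots and the level at which an eigenvalue appears -/

/-- The response matrix `(a, b; b, a)` of the graph of level `k - 1` between its boundary vertices,
at the spectral parameter `l`. -/
noncomputable def response : ℕ → ℝ → ℝ × ℝ
  | 0, _ => (1, -1)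
  | 1, _ => (1, -1)
  | k + 2, l =>
    let q := (response k l).2 ^ 2 /
      (l - 2 * (response k l).1 - 2 * ((response (k + 1) l).1 + (response (k + 1) l).2))
    ((response k l).1 + q, q)

/-- The diagonal entry `a` of the response matrix. -/
noncomputable def respA (k : ℕ) (l : ℝ) : ℝ := (response k l).1

/-- The off-diagonal entry `b` of the response matrix. -/
noncomputable def respB (k : ℕ) (l : ℝ) : ℝ := (response k l).2

/-- The pivot of the elimination step at level `k + 1`. -/
noncomputable def pivot (k : ℕ) (l : ℝ) : ℝ :=
  l - 2 * respA k l - 2 * (respA (k + 1) l + respB (k + 1) l)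

theorem respB_add_two (k : ℕ) (l : ℝ) :
    respB (k + 2) l = respB k l ^ 2 / pivot k l := by
  simp only [respB, pivot, respA, response]

theorem respA_add_two (k : ℕ) (l : ℝ) :
    respA (k + 2) l = respA k l + respB (k + 2) l := by
  simp only [respB, respA, response]

theorem pivot_succ (k : ℕ) (l : ℝ) :
    pivot (k + 1) l = pivot k l + 2 * respB (k + 1) l - 4 * respB (k + 2) l := by
  rw [pivot, pivot, respA_add_two]
  ring

/-- Each elimination turns `a`-responses into `b`-responses, so the pair of consecutive responses
advances by one index. -/
theorem hasKernel_graph_iff (l : ℝ) (k m : ℕ) (h : ∀ i < k, pivot i l ≠ 0) :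
    (graph (m + k)).HasKernel (respA 0 l) (respB 0 l) (respA 1 l) (respB 1 l) l ↔
      (graph m).HasKernel (respA k l) (respB k l) (respA (k + 1) l) (respB (k + 1) l) l := by
  induction k generalizing m with
  | zero => rfl
  | succ k ih =>
    have := ih (m + 1) fun i hi => h i (hi.trans k.lt_succ_self)
    rw [show m + (k + 1) = m + 1 + k by ring, this]
    rw [show k + 1 + 1 = k + 2 from rfl, respA_add_two, respB_add_two]
    exact (graph m).hasKernel_replace_iff _ _ _ _ l (h k k.lt_succ_self)

theorem mem_dirichletSpectrum_iff_hasKernel (n : ℕ) (l : ℝ) :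
    l ∈ dirichletSpectrum n ↔
      (graph n).HasKernel (respA 0 l) (respB 0 l) (respA 1 l) (respB 1 l) l :=
  (graph n).mem_spectrum_iff l

theorem notMem_dirichletSpectrum (n : ℕ) (l : ℝ) (h : ∀ i < n, pivot i l ≠ 0) :
    l ∉ dirichletSpectrum n := by
  have := hasKernel_graph_iff l n 0 h
  rw [zero_add] at this
  rw [mem_dirichletSpectrum_iff_hasKernel, this]
  exact not_hasKernel_initialGraph _ _ _ _ l

theorem mem_dirichletSpectrum_succ (n : ℕ) (l : ℝ) (h : ∀ i < n, pivot i l ≠ 0)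
    (h0 : pivot n l = 0) : l ∈ dirichletSpectrum (n + 1) := by
  rw [add_comm, mem_dirichletSpectrum_iff_hasKernel, hasKernel_graph_iff l n 1 h]
  exact hasKernel_replace_initialGraph _ _ _ _ l h0

/-- The pivots at an eigenvalue that is first seen at level `n + 1`. -/
theorem pivot_of_first_eigenvalue (n : ℕ) (l : ℝ) (hl : l ∈ dirichletSpectrum (n + 1))
    (hlow : ∀ k < n + 1, l ∉ dirichletSpectrum k) :
    (∀ i < n, pivot i l ≠ 0) ∧ pivot n l = 0 := by
  have h1 : ∀ i < n, pivot i l ≠ 0 := by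
    intro i
    induction i using Nat.strong_induction_on with
    | _ i ih =>
      intro hi h0
      -- A first vanishing pivot of index `i < n` would already produce an eigenvalue at level `i +
      -- 1`.
      exact hlow (i + 1) (by omega)
        (mem_dirichletSpectrum_succ i l (fun j hj => ih j hj (hj.trans hi)) h0)
  refine ⟨h1, by_contra fun h0 => notMem_dirichletSpectrum (n + 1) l (fun i hi => ?_) hl⟩
  rcases Nat.lt_succ_iff_lt_or_eq.1 hi with hi | rfl
  · exact h1 i hi
  · exact h0

theorem isRoot_dirichletCharpoly_iff (n : ℕ) (l : ℝ) :
    (dirichletCharpoly n).IsRoot l ↔ l ∈ dirichletSpectrum n :=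
  Matrix.mem_spectrum_iff_isRoot_charpoly.symm

theorem first_eigenvalue_of_zeta_eval_eq_zero (n : ℕ) (t : ℝ)
    (hpole : (zeta n).denom.eval t ≠ 0) (hzero : (zeta n).eval (RingHom.id ℝ) t = 0) :
    t ∈ dirichletSpectrum n ∧ ∀ k < n, t ∉ dirichletSpectrum k := by
  classical
  have hmonic : ∀ k, (gamma k).Monic := fun k =>
    monic_multiset_prod_of_monic _ _ fun t _ => monic_X_sub_C t
  have heta : eta n ≠ 0 :=
    ((hmonic _).mul (monic_prod_of_monic _ _ fun k _ => (hmonic _).pow _)).ne_zero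
  have hnum : (zeta n).num.eval t = 0 := by
    rw [RatFunc.eval, eval₂_id, eval₂_id, div_eq_zero_iff] at hzero
    exact hzero.resolve_right hpole
  -- Cancellation in the fraction is harmless: the reduced numerator divides `gamma n`.
  have hg : (gamma n).eval t = 0 :=
    eval_eq_zero_of_dvd_of_eval_eq_zero (RatFunc.num_div_dvd _ heta) hnum
  have hmem : t ∈ (gamma n).roots := (mem_roots (hmonic n).ne_zero).2 hg
  rw [gamma, roots_multiset_prod_X_sub_C, Multiset.mem_filter] at hmem
  exact ⟨(isRoot_dirichletCharpoly_iff n t).1 (mem_roots'.1 hmem.1).2,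
    fun k hk h => hmem.2 k hk ((isRoot_dirichletCharpoly_iff k t).2 h)⟩

/-! ### Escape and oscillation in the pivot recursion -/

/-- Two steps of the recursion preserve the escape region. -/
theorem escape_step {y B w w' D B' y' : ℝ} (hy : 0 < y) (hB : 0 < B) (hw : |w| ≤ y / 8)
    (hw' : w' = w ^ 2 / y) (hD : D = y + 2 * B - 4 * w') (hB' : B' = B ^ 2 / D)
    (hy' : y' = D + 2 * w' - 4 * B') : 0 < D ∧ 0 < y' ∧ 0 < B' ∧ |w'| ≤ y' / 8 := by
  have h0 : 0 ≤ w' := hw' ▸ by positivity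
  have h1 : w' ≤ y / 64 := by
    rw [hw', div_le_iff₀ hy]
    have := sq_le_sq' (abs_le.1 hw).1 (abs_le.1 hw).2
    nlinarith
  have hD0 : 0 < D := by linarith
  -- From `D - 4 * B ^ 2 / D = (D - 2 * B) * (1 + 2 * B / D)` with `D - 2 * B = y - 4 * w'`: large
  -- terms in `B` cancel.
  have h2 : y' = y - 2 * w' + 2 * B * (y - 4 * w') / D := by
    rw [hy', hB']
    field_simp
    rw [hD]; ring
  have h3 : 0 ≤ 2 * B * (y - 4 * w') / D := by
    have : 0 ≤ y - 4 * w' := by linarith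
    positivity
  refine ⟨hD0, by linarith, hB' ▸ by positivity, ?_⟩
  rw [abs_of_nonneg h0]
  linarith

/-- Two steps of the recursion outside the escape region: the ratio `y / B` grows. -/
theorem oscillation_step {y B w w' D B' y' : ℝ} (hy : 0 < y) (hB : 0 < B) (hw : |w| ≤ y / 8)
    (hw' : w' = -(w ^ 2 / y)) (hD : D = -y + 2 * B - 4 * w') (hD0 : 0 < D) (hB' : B' = B ^ 2 / D)
    (hy' : -y' = D + 2 * w' - 4 * B') :
    0 < y' ∧ 0 < B' ∧ |w'| ≤ y' / 8 ∧ y / B < 4 ∧ 3 / 2 * (y / B) ≤ y' / B' := by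
  have h0 : w' ≤ 0 := by rw [hw', neg_nonpos]; positivity
  have h1 : -w' ≤ y / 64 := by
    rw [hw', neg_neg, div_le_iff₀ hy]
    have := sq_le_sq' (abs_le.1 hw).1 (abs_le.1 hw).2
    nlinarith
  have hB0 : 0 < B' := hB' ▸ by positivity
  have h2 : y' = y + 2 * w' + 2 * B * (y + 4 * w') / D := by
    rw [← neg_inj, hy', hB']
    field_simp
    rw [hD]; ring
  have h4 : 0 ≤ y + 4 * w' := by linarith
  have h3 : 0 ≤ 2 * B * (y + 4 * w') / D := by positivity
  refine ⟨by linarith, hB0, ?_, ?_, ?_⟩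
  · rw [abs_of_nonpos h0]; linarith
  -- Positivity of `D` forces `y < 2 * B - 4 * w' ≤ 2 * B + y / 16`.
  · rw [div_lt_iff₀ hB]; linarith
  · have h5 : y' / B' = D * (y + 2 * w') / B ^ 2 + 2 * (y + 4 * w') / B := by
      rw [h2, hB']
      field_simp
    have h6 : 0 ≤ D * (y + 2 * w') / B ^ 2 := by
      have : 0 ≤ y + 2 * w' := by linarith
      positivity
    -- Since `-w' ≤ y / 64`, the factor is in fact at least `15 / 8`.
    have h7 : 3 / 2 * (y / B) ≤ 2 * (y + 4 * w') / B := by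
      rw [← mul_div_assoc]
      exact div_le_div_of_nonneg_right (by linarith) hB.le
    linarith

/-- The coupled recursion satisfied by the pivots and the off-diagonal responses. -/
def IsPivotSeq (z b : ℕ → ℝ) : Prop :=
  ∀ k, z (k + 1) = z k + 2 * b (k + 1) - 4 * b (k + 2) ∧ b (k + 2) = b k ^ 2 / z k

theorem IsPivotSeq.neg {z b : ℕ → ℝ} (h : IsPivotSeq z b) :
    IsPivotSeq (fun k => -z k) (fun k => -b k) := by
  intro k
  refine ⟨?_, ?_⟩
  · simp only; rw [(h k).1]; ring
  · simp only; rw [(h k).2, neg_sq, div_neg]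

theorem IsPivotSeq.escape {z b : ℕ → ℝ} (h : IsPivotSeq z b) (m : ℕ) (hz : 0 < z m)
    (hb : 0 < b (m + 1)) (hw : |b m| ≤ z m / 8) (k : ℕ) (hk : m ≤ k) : 0 < z k := by
  have key : ∀ j, 0 < z (m + 2 * j) ∧ 0 < b (m + 2 * j + 1) ∧
      |b (m + 2 * j)| ≤ z (m + 2 * j) / 8 ∧ 0 < z (m + 2 * j + 1) := by
    have step : ∀ i, 0 < z i → 0 < b (i + 1) → |b i| ≤ z i / 8 →
        0 < z (i + 1) ∧ 0 < z (i + 2) ∧ 0 < b (i + 3) ∧ |b (i + 2)| ≤ z (i + 2) / 8 := by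
      intro i h1 h2 h3
      exact escape_step h1 h2 h3 (h i).2 (h i).1 (h (i + 1)).2 (h (i + 1)).1
    intro j
    induction j with
    | zero => exact ⟨hz, hb, hw, (step m hz hb hw).1⟩
    | succ j ih =>
      obtain ⟨-, h2, h3, h4⟩ := step _ ih.1 ih.2.1 ih.2.2.1
      exact ⟨h2, h3, h4, (step _ h2 h3 h4).1⟩
  obtain ⟨i, rfl⟩ := Nat.exists_eq_add_of_le hk
  rcases Nat.even_or_odd' i with ⟨j, rfl | rfl⟩
  · exact (key j).1
  · exact (key j).2.2.2

/-- As long as the odd-offset pivots are positive, the even-offset ones stay negative, and the ratio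
`-z / b` grows geometrically while remaining below 4. -/
theorem IsPivotSeq.oscillation {z b : ℕ → ℝ} (h : IsPivotSeq z b) (m : ℕ) (hz : z m < 0)
    (hb : 0 < b (m + 1)) (hw : |b m| ≤ -z m / 8) (j : ℕ)
    (hpos : ∀ i < j, 0 < z (m + 2 * i + 1)) :
    z (m + 2 * j) < 0 ∧ 0 < b (m + 2 * j + 1) ∧ |b (m + 2 * j)| ≤ -z (m + 2 * j) / 8 ∧
      (3 / 2 : ℝ) ^ j * (-z m / b (m + 1)) ≤ -z (m + 2 * j) / b (m + 2 * j + 1) ∧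
      (0 < z (m + 2 * j + 1) → -z (m + 2 * j) / b (m + 2 * j + 1) < 4) := by
  have step : ∀ i, z i < 0 → 0 < b (i + 1) → |b i| ≤ -z i / 8 → 0 < z (i + 1) →
      0 < -z (i + 2) ∧ 0 < b (i + 3) ∧ |b (i + 2)| ≤ -z (i + 2) / 8 ∧ -z i / b (i + 1) < 4 ∧
        3 / 2 * (-z i / b (i + 1)) ≤ -z (i + 2) / b (i + 3) := by
    intro i h1 h2 h3 h4
    refine oscillation_step (neg_pos.2 h1) h2 h3 ?_ ?_ h4 (h (i + 1)).2 ?_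
    · rw [(h i).2, div_neg, neg_neg]
    · rw [(h i).1, neg_neg]
    · rw [neg_neg]; exact (h (i + 1)).1
  induction j with
  | zero =>
    refine ⟨hz, hb, hw, by simp, fun h4 => (step m hz hb hw h4).2.2.2.1⟩
  | succ j ih =>
    obtain ⟨i1, i2, i3, i4, -⟩ := ih fun i hi => hpos i (hi.trans j.lt_succ_self)
    obtain ⟨s1, s2, s3, -, s5⟩ := step _ i1 i2 i3 (hpos j j.lt_succ_self)
    refine ⟨neg_pos.1 s1, s2, s3, ?_, fun h4 => (step _ (neg_pos.1 s1) s2 s3 h4).2.2.2.1⟩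
    refine le_trans ?_ s5
    rw [pow_succ]
    linarith

theorem IsPivotSeq.exists_nonpos {z b : ℕ → ℝ} (h : IsPivotSeq z b) (m : ℕ) (hz : z m < 0)
    (hb : 0 < b (m + 1)) (hw : |b m| ≤ -z m / 8) : ∃ j, z (m + 2 * j + 1) ≤ 0 := by
  by_contra! hpos
  have hr : 0 < -z m / b (m + 1) := div_pos (neg_pos.2 hz) hb
  obtain ⟨j, hj⟩ := pow_unbounded_of_one_lt (4 / (-z m / b (m + 1)))
    (by norm_num : (1 : ℝ) < 3 / 2)
  rw [div_lt_iff₀ hr] at hj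
  obtain ⟨-, -, -, h4, h5⟩ := h.oscillation m hz hb hw j fun i _ => hpos i
  linarith [h5 (hpos j)]

/-- Near a point at which `b (m + 1)` blows up, the recursion oscillates, and the pivots of odd
index past `m` vanish at points that tend to it. -/
theorem exists_pivot_eq_zero (z b : ℕ → ℝ → ℝ) (m : ℕ) (δ : ℝ) (hδ : 0 < δ) (y₀ : ℝ)
    (hy₀ : y₀ < 0) (hseq : ∀ e, IsPivotSeq (fun k => z k e) (fun k => b k e))
    (hcont : ∀ e k, (∀ i < k, z i e ≠ 0) → ContinuousAt (z k) e)
    (hne : ∀ e ∈ Set.Ioo 0 δ, ∀ i < m, z i e ≠ 0)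
    (hz : Tendsto (z m) (𝓝[>] 0) (𝓝 y₀)) (hb : Tendsto (b (m + 1)) (𝓝[>] 0) atTop)
    (hw : Tendsto (b m) (𝓝[>] 0) (𝓝 0)) (K : ℕ) :
    ∃ e ∈ Set.Ioo 0 δ, ∃ j ≥ K, z (m + 2 * j + 1) e = 0 ∧
      ∀ i < m + 2 * j + 1, z i e ≠ 0 := by
  -- For each fixed `j` the oscillating pattern persists in the limit, the limit of the even-offset
  -- pivot doubling every two steps.
  have hlim : ∀ j, (∃ y < 0, Tendsto (z (m + 2 * j)) (𝓝[>] 0) (𝓝 y)) ∧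
      Tendsto (b (m + 2 * j + 1)) (𝓝[>] 0) atTop ∧ Tendsto (b (m + 2 * j)) (𝓝[>] 0) (𝓝 0) ∧
      Tendsto (z (m + 2 * j + 1)) (𝓝[>] 0) atTop := by
    have step1 : ∀ (i : ℕ) (y : ℝ), y < 0 → Tendsto (z i) (𝓝[>] 0) (𝓝 y) →
        Tendsto (b (i + 1)) (𝓝[>] 0) atTop → Tendsto (b i) (𝓝[>] 0) (𝓝 0) →
        Tendsto (b (i + 2)) (𝓝[>] 0) (𝓝 0) ∧ Tendsto (z (i + 1)) (𝓝[>] 0) atTop := by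
      intro i y hy h1 h2 h3
      have h4 : Tendsto (b (i + 2)) (𝓝[>] 0) (𝓝 0) := by
        have := (h3.pow 2).div h1 hy.ne
        simp only [ne_eq, OfNat.ofNat_ne_zero, not_false_eq_true, zero_pow, zero_div] at this
        exact this.congr fun e => ((hseq e i).2).symm
      refine ⟨h4, ?_⟩
      have := (h1.sub (h4.const_mul 4)).add_atTop (h2.const_mul_atTop (zero_lt_two (α := ℝ)))
      refine this.congr fun e => ?_
      have q := (hseq e i).1
      simp only at q
      rw [q]; ring
    have step2 : ∀ (i : ℕ) (y : ℝ), y < 0 → Tendsto (z i) (𝓝[>] 0) (𝓝 y) →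
        Tendsto (b (i + 1)) (𝓝[>] 0) atTop → Tendsto (b i) (𝓝[>] 0) (𝓝 0) →
        Tendsto (z (i + 2)) (𝓝[>] 0) (𝓝 (2 * y)) ∧ Tendsto (b (i + 3)) (𝓝[>] 0) atTop := by
      intro i y hy h1 h2 h3
      obtain ⟨h4, h5⟩ := step1 i y hy h1 h2 h3
      have h6 : Tendsto (fun e => z (i + 1) e / b (i + 1) e) (𝓝[>] 0) (𝓝 2) := by
        have h7 := (h1.sub (h4.const_mul 4)).div_atTop h2
        have h8 := h7.const_add 2
        rw [add_zero] at h8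
        refine h8.congr' ?_
        filter_upwards [h2.eventually_gt_atTop 0] with e he
        have he' := he.ne'
        have q := (hseq e i).1
        simp only at q
        rw [q]
        field_simp
        ring
      have h9 : Tendsto (fun e => b (i + 1) e / z (i + 1) e) (𝓝[>] 0) (𝓝 (1 / 2)) := by
        refine (h6.inv₀ two_ne_zero).congr (fun e => inv_div _ _) |>.trans ?_
        norm_num
      have hb3 : Tendsto (b (i + 3)) (𝓝[>] 0) atTop := by
        refine (h2.atTop_mul_pos (by norm_num) h9).congr fun e => ?_
        have := (hseq e (i + 1)).2
        simp only [show i + 1 + 2 = i + 3 from rfl] at this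
        rw [this]; ring
      refine ⟨?_, hb3⟩
      have h10 := (h1.sub (h4.const_mul 2)).add
        ((h9.const_mul 2).mul (h1.sub (h4.const_mul 4)))
      have e1 : y - 2 * 0 + 2 * (1 / 2) * (y - 4 * 0) = 2 * y := by ring
      rw [e1] at h10
      refine h10.congr' ?_
      filter_upwards [h5.eventually_gt_atTop 0] with e he
      have he' := he.ne'
      have q1 := (hseq e (i + 1)).1
      have q2 := (hseq e (i + 1)).2
      have q3 := (hseq e i).1
      simp only [show i + 1 + 1 = i + 2 from rfl, show i + 1 + 2 = i + 3 from rfl] at q1 q2 q3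
      rw [q1, q2]
      field_simp
      rw [q3]
      ring
    intro j
    induction j with
    | zero => exact ⟨⟨y₀, hy₀, hz⟩, hb, hw, (step1 m y₀ hy₀ hz hb hw).2⟩
    | succ j ih =>
      obtain ⟨⟨y, hy, h1⟩, h2, h3, -⟩ := ih
      obtain ⟨s1, s2⟩ := step2 _ y hy h1 h2 h3
      have s3 := (step1 _ y hy h1 h2 h3).1
      have hy2 : 2 * y < 0 := by linarith
      exact ⟨⟨2 * y, hy2, s1⟩, s2, s3, (step1 _ _ hy2 s1 s2 s3).2⟩
  have hev : ∀ᶠ e in 𝓝[>] (0 : ℝ), z m e < 0 ∧ 0 < b (m + 1) e ∧ |b m e| ≤ -z m e / 8 ∧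
      ∀ j < K, 0 < z (m + 2 * j + 1) e := by
    have h1 := hz.eventually_lt_const hy₀
    have h2 := hb.eventually_gt_atTop 0
    have h3 : ∀ᶠ e in 𝓝[>] (0 : ℝ), |b m e| < -z m e / 8 := by
      refine Tendsto.eventually_lt hw.abs (hz.neg.div_const 8) ?_
      rw [abs_zero]; linarith
    have h4 : ∀ᶠ e in 𝓝[>] (0 : ℝ), ∀ j ∈ Set.Iio K, 0 < z (m + 2 * j + 1) e :=
      (eventually_all_finite (Set.finite_Iio K)).2 fun j _ =>
        (hlim j).2.2.2.eventually_gt_atTop 0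
    filter_upwards [h1, h2, h3, h4] with e e1 e2 e3 e4 using ⟨e1, e2, e3.le, e4⟩
  obtain ⟨ε, hε, hεs⟩ := (mem_nhdsGT_iff_exists_Ioo_subset).1 hev
  have hε0 : 0 < ε := hε
  set r := min ε δ / 2 with hr
  have hm0 : 0 < min ε δ := lt_min hε0 hδ
  have hr0 : 0 < r := by positivity
  have hrlt : ∀ e ∈ Set.Ioc 0 r, e < ε ∧ e < δ := fun e he =>
    lt_min_iff.1 (he.2.trans_lt (half_lt_self hm0))
  have hgood : ∀ e ∈ Set.Ioc 0 r, z m e < 0 ∧ 0 < b (m + 1) e ∧ |b m e| ≤ -z m e / 8 ∧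
      ∀ j < K, 0 < z (m + 2 * j + 1) e := fun e he => hεs ⟨he.1, (hrlt e he).1⟩
  classical
  have hex : ∃ j, ∃ e ∈ Set.Ioc 0 r, z (m + 2 * j + 1) e ≤ 0 := by
    obtain ⟨g1, g2, g3, -⟩ := hgood r ⟨hr0, le_rfl⟩
    obtain ⟨j, hj⟩ := (hseq r).exists_nonpos m g1 g2 g3
    exact ⟨j, r, ⟨hr0, le_rfl⟩, hj⟩
  obtain ⟨e₁, he₁, hle⟩ := Nat.find_spec hex
  -- Minimality of `j` over the whole interval, not at one point, keeps all earlier pivots nonzero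
  -- there, so `z (m + 2 * j + 1)` is continuous on it.
  have hmin : ∀ i < Nat.find hex, ∀ e ∈ Set.Ioc 0 r, 0 < z (m + 2 * i + 1) e := by
    intro i hi e he
    by_contra! hcon
    exact Nat.find_min hex hi ⟨e, he, hcon⟩
  set j := Nat.find hex with hj
  -- The radius was chosen so that the first `K` odd-offset pivots are positive throughout.
  have hK : K ≤ j := by
    by_contra! hlt
    exact absurd ((hgood e₁ he₁).2.2.2 j hlt) hle.not_gt
  have hprev : ∀ e ∈ Set.Ioc 0 r, ∀ i < m + 2 * j + 1, z i e ≠ 0 := by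
    intro e he i hi
    rcases lt_or_ge i m with him | him
    · exact hne e ⟨he.1, (hrlt e he).2⟩ i him
    · obtain ⟨g1, g2, g3, -⟩ := hgood e he
      obtain ⟨c, rfl⟩ := Nat.exists_eq_add_of_le him
      rcases Nat.even_or_odd' c with ⟨d, rfl | rfl⟩
      · exact ((hseq e).oscillation m g1 g2 g3 d
          fun i' hi' => hmin i' (by omega) e he).1.ne
      · exact (hmin d (by omega) e he).ne'
  obtain ⟨e₂, he₂, hpos⟩ : ∃ e₂ ∈ Set.Ioo 0 e₁, 0 < z (m + 2 * j + 1) e₂ := by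
    have h1 := (hlim j).2.2.2.eventually_gt_atTop 0
    have h2 : ∀ᶠ e in 𝓝[>] (0 : ℝ), e ∈ Set.Ioo 0 e₁ := Ioo_mem_nhdsGT he₁.1
    exact (h2.and h1).exists
  have hsub : Set.Icc e₂ e₁ ⊆ Set.Ioc 0 r := fun e he =>
    ⟨he₂.1.trans_le he.1, he.2.trans he₁.2⟩
  have hco : ContinuousOn (z (m + 2 * j + 1)) (Set.Icc e₂ e₁) := fun e he =>
    (hcont e _ (hprev e (hsub he))).continuousWithinAt
  obtain ⟨e, he, he0⟩ := intermediate_value_Icc' he₂.2.le hco ⟨hle, hpos.le⟩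
  exact ⟨e, ⟨(hsub he).1, (hrlt e (hsub he)).2⟩, j, hK, he0, hprev e (hsub he)⟩

/-! ### Blow-up of the recursion at a vanishing pivot -/

theorem isPivotSeq_pivot (l : ℝ) : IsPivotSeq (fun k => pivot k l) (fun k => respB k l) :=
  fun k => ⟨pivot_succ k l, respB_add_two k l⟩

/-- The behaviour of the recursion when a pivot tends to zero from below. -/
theorem tendsto_of_pivot_tendsto_zero {F : Filter ℝ} (z b : ℕ → ℝ → ℝ) (n : ℕ) (c d : ℝ)
    (hc : c ≠ 0) (hseq : ∀ e, IsPivotSeq (fun k => z k e) (fun k => b k e))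
    (hz : Tendsto (z n) F (𝓝 0)) (hneg : ∀ᶠ e in F, z n e < 0)
    (hb0 : Tendsto (b n) F (𝓝 c)) (hb1 : Tendsto (b (n + 1)) F (𝓝 d)) :
    Tendsto (z (n + 1)) F atTop ∧ Tendsto (z (n + 2)) F atTop ∧
      Tendsto (z (n + 3)) F (𝓝 (4 * d)) ∧ Tendsto (b (n + 3)) F (𝓝 0) ∧
      Tendsto (b (n + 4)) F atTop := by
  have r0 : ∀ e, b (n + 2) e = b n e ^ 2 / z n e := fun e => (hseq e n).2
  have r1 : ∀ e, z (n + 1) e = z n e + 2 * b (n + 1) e - 4 * b (n + 2) e := fun e => (hseq e n).1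
  have r2 : ∀ e, b (n + 3) e = b (n + 1) e ^ 2 / z (n + 1) e := fun e => (hseq e (n + 1)).2
  have r3 : ∀ e, z (n + 2) e = z (n + 1) e + 2 * b (n + 2) e - 4 * b (n + 3) e :=
    fun e => (hseq e (n + 1)).1
  have r4 : ∀ e, b (n + 4) e = b (n + 2) e ^ 2 / z (n + 2) e := fun e => (hseq e (n + 2)).2
  have r5 : ∀ e, z (n + 3) e = z (n + 2) e + 2 * b (n + 3) e - 4 * b (n + 4) e :=
    fun e => (hseq e (n + 2)).1
  have hB : Tendsto (b (n + 2)) F atBot := by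
    have h1 : Tendsto (z n) F (𝓝[<] 0) := tendsto_nhdsWithin_iff.2 ⟨hz, hneg⟩
    have h2 := (hb0.pow 2).pos_mul_atBot (by positivity) h1.inv_tendsto_nhdsLT_zero
    exact h2.congr fun e => (r0 e).symm
  have hBne : ∀ᶠ e in F, b (n + 2) e ≠ 0 := (hB.eventually_lt_atBot 0).mono fun e he => he.ne
  have hR1 : Tendsto (fun e => z (n + 1) e / b (n + 2) e) F (𝓝 (-4)) := by
    have := ((hz.add (hb1.const_mul 2)).div_atBot hB).sub_const 4
    rw [zero_sub] at this
    refine this.congr' ?_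
    filter_upwards [hBne] with e he
    rw [r1]
    field_simp
  have hZ1 : Tendsto (z (n + 1)) F atTop := by
    refine (hB.atBot_mul_neg (by norm_num) hR1).congr' ?_
    filter_upwards [hBne] with e he
    field_simp
  have hB3 : Tendsto (b (n + 3)) F (𝓝 0) :=
    ((hb1.pow 2).div_atTop hZ1).congr fun e => (r2 e).symm
  -- This combination equals `z (n + 2) + 2 * b (n + 2)`, in which the divergent parts cancel. It is
  -- a factor of `z (n + 3) - 2 * b (n + 3)`, the other being `1 - 2 * b (n + 2) / z (n + 2)`, with
  -- limit 2.
  have hs : Tendsto (fun e => z n e + 2 * b (n + 1) e - 4 * b (n + 3) e) F (𝓝 (2 * d)) := by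
    have := (hz.add (hb1.const_mul 2)).sub (hB3.const_mul 4)
    simpa using this
  have hR2 : Tendsto (fun e => z (n + 2) e / b (n + 2) e) F (𝓝 (-2)) := by
    have := (hs.div_atBot hB).sub_const 2
    rw [zero_sub] at this
    refine this.congr' ?_
    filter_upwards [hBne] with e he
    rw [r3, r1]
    field_simp
    ring
  have hZ2 : Tendsto (z (n + 2)) F atTop := by
    refine (hB.atBot_mul_neg (by norm_num) hR2).congr' ?_
    filter_upwards [hBne] with e he
    field_simp
  have hZ2ne : ∀ᶠ e in F, z (n + 2) e ≠ 0 := (hZ2.eventually_gt_atTop 0).mono fun e he => he.ne'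
  have hR2i := hR2.inv₀ (by norm_num)
  refine ⟨hZ1, hZ2, ?_, hB3, ?_⟩
  · have := (hB3.const_mul 2).add (hs.mul ((hR2i.const_mul 2).const_sub 1))
    have e1 : 2 * 0 + 2 * d * (1 - 2 * (-2 : ℝ)⁻¹) = 4 * d := by norm_num; ring
    rw [e1] at this
    refine this.congr' ?_
    filter_upwards [hBne, hZ2ne] with e he he2
    have hs' : z n e + 2 * b (n + 1) e - 4 * b (n + 3) e = z (n + 2) e + 2 * b (n + 2) e := by
      rw [r3, r1]; ring
    rw [hs', r5, r4]
    field_simp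
    ring
  · refine (hB.atBot_mul_neg (by norm_num) hR2i).congr fun e => ?_
    rw [r4, inv_div]
    ring

/-! ### Monotonicity in the spectral parameter -/

theorem respB_ne_zero (l : ℝ) (k : ℕ) (h : ∀ i < k, pivot i l ≠ 0) :
    respB k l ≠ 0 ∧ respB (k + 1) l ≠ 0 := by
  induction k with
  | zero => constructor <;> simp [respB, response]
  | succ k ih =>
    obtain ⟨h1, h2⟩ := ih fun i hi => h i (hi.trans k.lt_succ_self)
    refine ⟨h2, ?_⟩
    rw [respB_add_two]
    exact div_ne_zero (pow_ne_zero 2 h1) (h k k.lt_succ_self)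

/-- The inequality `|b| ≤ -a` says that the derivative of the response matrix is negative
semidefinite, its eigenvalues being `a ± b`. The recursion preserves this. -/
theorem response_hasDerivAt (l : ℝ) (k : ℕ) (h : ∀ i < k, pivot i l ≠ 0) :
    (∃ a b, HasDerivAt (respA k) a l ∧ HasDerivAt (respB k) b l ∧ |b| ≤ -a) ∧
      ∃ a b, HasDerivAt (respA (k + 1)) a l ∧ HasDerivAt (respB (k + 1)) b l ∧ |b| ≤ -a := by
  induction k with
  | zero =>
    exact ⟨⟨0, 0, hasDerivAt_const l (1 : ℝ), hasDerivAt_const l (-1 : ℝ), by simp⟩,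
      ⟨0, 0, hasDerivAt_const l (1 : ℝ), hasDerivAt_const l (-1 : ℝ), by simp⟩⟩
  | succ k ih =>
    obtain ⟨⟨a₀, b₀, ha₀, hb₀, h₀⟩, h₁⟩ := ih fun i hi => h i (hi.trans k.lt_succ_self)
    refine ⟨h₁, ?_⟩
    obtain ⟨a₁, b₁, ha₁, hb₁, h₁⟩ := h₁
    have hz : pivot k l ≠ 0 := h k k.lt_succ_self
    have hdz : HasDerivAt (pivot k) (1 - 2 * a₀ - 2 * (a₁ + b₁)) l :=
      ((hasDerivAt_id l).sub (ha₀.const_mul 2)).sub ((ha₁.add hb₁).const_mul 2)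
    set w := 1 - 2 * a₀ - 2 * (a₁ + b₁) with hw
    set x := respB k l / pivot k l with hx
    have hdb : HasDerivAt (respB (k + 2)) (2 * x * b₀ - x ^ 2 * w) l := by
      have h2 : respB (k + 2) = fun l => respB k l ^ 2 / pivot k l :=
        funext fun l => respB_add_two k l
      rw [h2]
      refine ((hb₀.pow 2).div hdz hz).congr_deriv ?_
      rw [hx, div_pow]
      simp only [Pi.pow_apply]
      field_simp
      push_cast
      ring
    have hda : HasDerivAt (respA (k + 2)) (a₀ + (2 * x * b₀ - x ^ 2 * w)) l := by
      have h2 : respA (k + 2) = fun l => respA k l + respB (k + 2) l :=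
        funext fun l => respA_add_two k l
      rw [h2]
      exact ha₀.add hdb
    refine ⟨_, _, hda, hdb, abs_le.2 ⟨?_, ?_⟩⟩
    · have := abs_nonneg b₀
      linarith
    · have hw1 : 1 - 2 * a₀ ≤ w := by
        have := (abs_le.1 h₁).2
        linarith
      have h3 : x * b₀ ≤ |x| * -a₀ :=
        (le_abs_self _).trans ((abs_mul x b₀).trans_le
          (mul_le_mul_of_nonneg_left h₀ (abs_nonneg x)))
      have h4 : x ^ 2 * (1 - 2 * a₀) ≤ x ^ 2 * w := mul_le_mul_of_nonneg_left hw1 (sq_nonneg x)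
      -- The required bound reduces to `-a₀ * (1 - 2 * |x|) ^ 2 + 2 * x ^ 2 ≥ 0`.
      have h5 : 0 ≤ -a₀ * (1 - 2 * |x|) ^ 2 :=
        mul_nonneg ((abs_nonneg b₀).trans h₀) (sq_nonneg _)
      rw [← sq_abs x] at h4 ⊢
      nlinarith [sq_nonneg |x|]

theorem pivot_hasDerivAt (l : ℝ) (k : ℕ) (h : ∀ i < k, pivot i l ≠ 0) :
    ∃ w, 1 ≤ w ∧ HasDerivAt (pivot k) w l := by
  obtain ⟨⟨a₀, b₀, ha₀, hb₀, h₀⟩, a₁, b₁, ha₁, hb₁, h₁⟩ := response_hasDerivAt l k h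
  refine ⟨1 - 2 * a₀ - 2 * (a₁ + b₁), ?_,
    ((hasDerivAt_id l).sub (ha₀.const_mul 2)).sub ((ha₁.add hb₁).const_mul 2)⟩
  have := (abs_le.1 h₁).2
  have := abs_nonneg b₀
  linarith

/-! ### The two sides of a first eigenvalue -/

/-- On the side of `t` to which `s` points, either the pivots escape or they oscillate. -/
theorem one_sided_dichotomy (n : ℕ) (t : ℝ) (h : ∀ i < n, pivot i t ≠ 0) (h0 : pivot n t = 0)
    (s : ℝ) (hs : s = 1 ∨ s = -1) :
    (s * respB (n + 1) t < 0 →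
      ∃ δ > 0, ∀ e ∈ Set.Ioo 0 δ, ∀ m, t + s * e ∉ dirichletSpectrum m) ∧
    (0 < s * respB (n + 1) t → ∀ δ > 0, ∀ K : ℕ,
      ∃ e ∈ Set.Ioo 0 δ, ∃ j ≥ K, t + s * e ∈ dirichletSpectrum (n + 1 + 2 * j)) := by
  have hss : s * s = 1 := by rcases hs with rfl | rfl <;> norm_num
  have hs0 : s ≠ 0 := fun h => by simp [h] at hss
  -- The factor `-s` makes the pivot of index `n` negative for small `e > 0` on either side; the
  -- recursion is invariant under a common change of sign.
  let z : ℕ → ℝ → ℝ := fun k e => -s * pivot k (t + s * e)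
  let b : ℕ → ℝ → ℝ := fun k e => -s * respB k (t + s * e)
  have hzne : ∀ k e, z k e ≠ 0 ↔ pivot k (t + s * e) ≠ 0 := by
    intro k e
    simp [z, hs0]
  have hseq : ∀ e, IsPivotSeq (fun k => z k e) (fun k => b k e) := by
    intro e
    have h1 := isPivotSeq_pivot (t + s * e)
    rcases hs with rfl | rfl
    · simpa [z, b] using h1.neg
    · simpa [z, b] using h1
  have haff : ∀ e : ℝ, ContinuousAt (fun e : ℝ => t + s * e) e := fun e => by fun_prop
  have hcont : ∀ e k, (∀ i < k, z i e ≠ 0) → ContinuousAt (z k) e := by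
    intro e k hk
    obtain ⟨w, -, hw⟩ := pivot_hasDerivAt (t + s * e) k fun i hi => (hzne i e).1 (hk i hi)
    exact (hw.continuousAt.comp (f := fun e : ℝ => t + s * e) (haff e)).const_mul (-s)
  have hz0 : ∀ i < n, z i 0 ≠ 0 := fun i hi => (hzne i 0).2 (by simpa using h i hi)
  have ht0 : t + s * 0 = t := by simp
  have hle : 𝓝[>] (0 : ℝ) ≤ 𝓝 0 := nhdsWithin_le_nhds
  have hlow : ∀ᶠ e in 𝓝[>] (0 : ℝ), ∀ i ∈ Set.Iio n, z i e ≠ 0 :=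
    (eventually_all_finite (Set.finite_Iio n)).2 fun i hi =>
      hle ((hcont 0 i fun i' hi' => hz0 i' (hi'.trans hi)).eventually_ne (hz0 i hi))
  obtain ⟨⟨a₀, b₀, -, hb₀, -⟩, a₁, b₁, -, hb₁, -⟩ := response_hasDerivAt t n h
  have htb : ∀ k, ContinuousAt (respB k) t → Tendsto (b k) (𝓝[>] 0) (𝓝 (-s * respB k t)) := by
    intro k hk
    have h1 : ContinuousAt (respB k) (t + s * 0) := by rwa [ht0]
    have h2 : ContinuousAt (b k) 0 :=
      (h1.comp (f := fun e : ℝ => t + s * e) (haff 0)).const_mul (-s)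
    have h3 := h2.tendsto.mono_left hle
    simpa only [b, ht0] using h3
  have hzt : Tendsto (z n) (𝓝[>] 0) (𝓝 0) := by
    have h3 := (hcont 0 n hz0).tendsto.mono_left hle
    simpa [z, h0] using h3
  have hneg : ∀ᶠ e in 𝓝[>] (0 : ℝ), z n e < 0 := by
    obtain ⟨w, hw1, hw⟩ := pivot_hasDerivAt t n h
    have h1 : HasDerivAt (z n) (-s * (w * s)) 0 := by
      have h2 : HasDerivAt (fun e : ℝ => t + s * e) s 0 := by
        simpa using ((hasDerivAt_id (0 : ℝ)).const_mul s).const_add t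
      have h3 : HasDerivAt (pivot n) w (t + s * 0) := by rwa [ht0]
      exact (h3.comp 0 h2).const_mul (-s)
    have h4 : -s * (w * s) = -w := by linear_combination (-w) * hss
    rw [h4, hasDerivAt_iff_tendsto_slope] at h1
    have h5 := (h1.mono_left (nhdsWithin_mono 0
      (fun e (he : (0 : ℝ) < e) => he.ne'))).eventually_lt_const (show -w < 0 by linarith)
    filter_upwards [h5, self_mem_nhdsWithin] with e he hpos
    have hpos' : (0 : ℝ) < e := hpos
    have h6 : z n 0 = 0 := by simp [z, h0]
    rw [slope_def_field, h6, sub_zero, sub_zero, div_lt_iff₀ hpos', zero_mul] at he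
    exact he
  obtain ⟨l1, l2, l3, l4, l5⟩ := tendsto_of_pivot_tendsto_zero z b n (-s * respB n t)
    (-s * respB (n + 1) t) (by simpa [hs0] using (respB_ne_zero t n h).1) hseq hzt hneg
    (htb n hb₀.continuousAt) (htb (n + 1) hb₁.continuousAt)
  have hlow3 : ∀ᶠ e in 𝓝[>] (0 : ℝ), ∀ i < n + 3, z i e ≠ 0 := by
    filter_upwards [hlow, hneg, l1.eventually_gt_atTop 0, l2.eventually_gt_atTop 0]
      with e e1 e2 e3 e4 i hi
    rcases lt_or_ge i n with hin | hin
    · exact e1 i hin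
    · have : i = n ∨ i = n + 1 ∨ i = n + 2 := by omega
      rcases this with rfl | rfl | rfl
      · exact e2.ne
      · exact e3.ne'
      · exact e4.ne'
  constructor
  · intro hsgn
    have hy : 0 < 4 * (-s * respB (n + 1) t) := by linarith
    have hw : ∀ᶠ e in 𝓝[>] (0 : ℝ), |b (n + 3) e| < z (n + 3) e / 8 := by
      refine Tendsto.eventually_lt l4.abs (l3.div_const 8) ?_
      rw [abs_zero]; linarith
    have hgap : ∀ᶠ e in 𝓝[>] (0 : ℝ), ∀ m, t + s * e ∉ dirichletSpectrum m := by
      filter_upwards [hlow3, l3.eventually_const_lt hy, l5.eventually_gt_atTop 0, hw]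
        with e e1 e2 e3 e4 m
      refine notMem_dirichletSpectrum m _ fun i _ => (hzne i e).1 ?_
      rcases lt_or_ge i (n + 3) with hi | hi
      · exact e1 i hi
      · exact ((hseq e).escape (n + 3) e2 e3 e4.le i hi).ne'
    obtain ⟨δ, hδ, hsub⟩ := mem_nhdsGT_iff_exists_Ioo_subset.1 hgap
    exact ⟨δ, hδ, hsub⟩
  · intro hsgn δ hδ K
    obtain ⟨δ', hδ', hsub⟩ := mem_nhdsGT_iff_exists_Ioo_subset.1 hlow3
    obtain ⟨e, he, j, hj, hzero, hne⟩ := exists_pivot_eq_zero z b (n + 3) (min δ δ')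
      (lt_min hδ hδ') _ (show 4 * (-s * respB (n + 1) t) < 0 by linarith) hseq hcont
      (fun e he => hsub ⟨he.1, he.2.trans_le (min_le_right _ _)⟩) l3 l5 l4 K
    -- The vanishing pivot has index `n + 3 + 2 * j + 1`, so its level is one higher, which is `n +
    -- 1 + 2 * (j + 2)`.
    refine ⟨e, ⟨he.1, he.2.trans_le (min_le_left _ _)⟩, j + 2, by omega, ?_⟩
    rw [show n + 1 + 2 * (j + 2) = n + 3 + 2 * j + 1 + 1 by ring]
    refine mem_dirichletSpectrum_succ _ _ (fun i hi => (hzne i e).1 (hne i hi)) ?_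
    exact not_not.1 fun hcon => (hzne _ e).2 hcon hzero

theorem eigenvaluesAccumulate_of_forall_exists (n : ℕ) (t : ℝ) (I : Set ℝ)
    (h : ∀ ε > 0, ∀ K : ℕ, ∃ x ∈ I, |x - t| < ε ∧ ∃ j ≥ K, x ∈ dirichletSpectrum (n + 2 * j)) :
    EigenvaluesAccumulate n t I := by
  choose! x hxI hxt k hk hx using h
  have hpos : ∀ j : ℕ, (0 : ℝ) < 1 / ((j : ℝ) + 1) := fun j => Nat.one_div_pos_of_nat
  refine ⟨fun j => k (1 / ((j : ℝ) + 1)) j, fun j => x (1 / ((j : ℝ) + 1)) j,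
    tendsto_atTop_mono (fun j => hk _ (hpos j) j) tendsto_id,
    fun j => ⟨hxI _ (hpos j) j, hx _ (hpos j) j⟩, ?_⟩
  rw [tendsto_iff_dist_tendsto_zero]
  exact squeeze_zero (fun _ => dist_nonneg) (fun j => (hxt _ (hpos j) j).le)
    tendsto_one_div_add_atTop_nhds_zero_nat

/-- The nonzero number `respB (n + 1) t` has a sign, and `s = 1`, `s = -1` then fall into opposite
cases of the dichotomy. -/
theorem exists_gap_and_accumulation (n : ℕ) (t : ℝ) (h : ∀ i < n, pivot i t ≠ 0)
    (h0 : pivot n t = 0) :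
    ∃ δ : ℝ, 0 < δ ∧
      ((IsGap (Set.Ioo (t - δ) t) ∧ EigenvaluesAccumulate (n + 1) t (Set.Ioo t (t + δ))) ∨
        (IsGap (Set.Ioo t (t + δ)) ∧ EigenvaluesAccumulate (n + 1) t (Set.Ioo (t - δ) t))) := by
  have hr := one_sided_dichotomy n t h h0 1 (Or.inl rfl)
  have hl := one_sided_dichotomy n t h h0 (-1) (Or.inr rfl)
  rcases lt_or_gt_of_ne (respB_ne_zero t n h).2 with hb | hb
  · obtain ⟨δ, hδ, hgap⟩ := hr.1 (by linarith)
    refine ⟨δ, hδ, Or.inr ⟨fun m => Set.disjoint_left.2 fun x hx => ?_,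
      eigenvaluesAccumulate_of_forall_exists _ _ _ fun ε hε K => ?_⟩⟩
    · have := hgap (x - t) ⟨by linarith [hx.1], by linarith [hx.2]⟩ m
      rwa [one_mul, add_sub_cancel] at this
    · obtain ⟨e, he, j, hj, hmem⟩ := hl.2 (by linarith) (min δ ε) (lt_min hδ hε) K
      obtain ⟨h1, h2⟩ := lt_min_iff.1 he.2
      refine ⟨_, ⟨by linarith, by linarith [he.1]⟩, ?_, j, hj, hmem⟩
      rw [add_sub_cancel_left, neg_one_mul, abs_neg, abs_of_pos he.1]
      exact h2
  · obtain ⟨δ, hδ, hgap⟩ := hl.1 (by linarith)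
    refine ⟨δ, hδ, Or.inl ⟨fun m => Set.disjoint_left.2 fun x hx => ?_,
      eigenvaluesAccumulate_of_forall_exists _ _ _ fun ε hε K => ?_⟩⟩
    · have := hgap (t - x) ⟨by linarith [hx.2], by linarith [hx.1]⟩ m
      rwa [neg_one_mul, neg_sub, add_sub_cancel] at this
    · obtain ⟨e, he, j, hj, hmem⟩ := hr.2 (by linarith) (min δ ε) (lt_min hδ hε) K
      obtain ⟨h1, h2⟩ := lt_min_iff.1 he.2
      refine ⟨_, ⟨by linarith [he.1], by linarith⟩, ?_, j, hj, hmem⟩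
      rw [add_sub_cancel_left, one_mul, abs_of_pos he.1]
      exact h2

end Basilica

theorem mainTheorem2 (n : ℕ) (hn : 1 ≤ n) (t : ℝ)
    (hpole : (Basilica.zeta n).denom.eval t ≠ 0)
    (hzero : (Basilica.zeta n).eval (RingHom.id ℝ) t = 0) :
    ∃ δ : ℝ, 0 < δ ∧
      ((Basilica.IsGap (Set.Ioo (t - δ) t) ∧
          Basilica.EigenvaluesAccumulate n t (Set.Ioo t (t + δ))) ∨
        (Basilica.IsGap (Set.Ioo t (t + δ)) ∧
          Basilica.EigenvaluesAccumulate n t (Set.Ioo (t - δ) t))) := by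
  obtain ⟨m, rfl⟩ := Nat.exists_eq_add_of_le' hn
  obtain ⟨hmem, hlow⟩ := Basilica.first_eigenvalue_of_zeta_eval_eq_zero _ t hpole hzero
  obtain ⟨h1, h2⟩ := Basilica.pivot_of_first_eigenvalue m t hmem hlow
  exact Basilica.exists_gap_and_accumulation m t h1 h2
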